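/- Let $1 < p \le 2 \le q < \infty$ with $p$ and $q$ not both equal to $2$. There is a constant $C = C_{p,q} > 0$, depending only on $p$ and $q$, such that the following holds. Let $L$ be a lattice in $\mathbb{R}^d$ (the $\mathbb{Z}$-span of $d$ linearly independent vectors), let $L^\perp = \{\kappa \in \mathbb{R}^d : \kappa\cdot\lambda \in \mathbb{Z} \text{ for all } \lambda \in L\}$ be its dual lattice, and let $\Omega$ be a fundamental domain of $L$, i.e. a measurable set containing exactly one representative of every coset of $\mathbb{R}^d/L$. Let $L^p(\Omega)$ denote the Lebesgue space with respect to the normalized measure $|\Omega|^{-1}dx$ on $\Omega$, let $C^\infty(\Omega)$ be the space of smooth $L$-periodic functions $\mathbb{R}^d \to \mathbb{C}$, and put $\widehat{f}(\kappa) = \frac{1}{|\Omega|}\int_\Omega f(x) e^{-2\pi i \kappa\cdot x}\,dx$ for $\kappa \in L^\perp$. Let $A : C^\infty(\Omega) \to C^\infty(\Omega)$ be a Fourier multiplier with symbol $\sigma : L^\perp \to \mathbb{C}$, i.e. $\widehat{Af}(\kappa) = \sigma(\kappa)\widehat{f}(\kappa)$ for all $f \in C^\infty(\Omega)$ and $\kappa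 \in L^\perp$, and suppose that $$M := \sup_{s>0} s\,\bigl(\#\{\kappa \in L^\perp : |\sigma(\kappa)| \ge s\}\bigr)^{\frac1p-\frac1q} < \infty .$$ Then $$\sup_{0 \ne f \in C^\infty(\Omega)} \frac{\|Af\|_{L^q(\Omega)}}{\|f\|_{L^p(\Omega)}} \le C\,M ,$$ and $A$ extends to a bounded linear operator $L^p(\Omega) \to L^q(\Omega)$ of norm at most $C M$. -/

import Mathlib

open MeasureTheory
open scoped ENNReal NNReal

noncomputable section

namespace LatticeFourier

/-- The dual lattice `L^⊥ = {κ | ∀ l ∈ L, κ · l ∈ ℤ}` of a lattice `L` in `ℝ^d`. -/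
def dualLattice {d : ℕ} (L : Submodule ℤ (EuclideanSpace ℝ (Fin d))) :
    Submodule ℤ (EuclideanSpace ℝ (Fin d)) :=
  LinearMap.BilinForm.dualSubmodule (innerₗ (EuclideanSpace ℝ (Fin d))) L

theorem mem_dualLattice {d : ℕ} {L : Submodule ℤ (EuclideanSpace ℝ (Fin d))}
    {κ : EuclideanSpace ℝ (Fin d)} :
    κ ∈ dualLattice L ↔ ∀ l ∈ L, ∃ n : ℤ, inner ℝ κ l = (n : ℝ) := by
  simp only [dualLattice, LinearMap.BilinForm.mem_dualSubmodule, Submodule.mem_one,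
    innerₗ_apply_apply, eq_intCast, eq_comm]

/-- A fundamental domain of `L`: a (Lebesgue) measurable set which contains exactly one
representative of every coset of `ℝ^d / L`. -/
structure IsFundDomain {d : ℕ} (L : Submodule ℤ (EuclideanSpace ℝ (Fin d)))
    (Ω : Set (EuclideanSpace ℝ (Fin d))) : Prop where
  nullMeasurableSet : NullMeasurableSet Ω volume
  existsUnique : ∀ x : EuclideanSpace ℝ (Fin d),
    ∃! l : EuclideanSpace ℝ (Fin d), l ∈ L ∧ x + l ∈ Ω

/-- The normalized Lebesgue measure `|Ω|⁻¹ dx` on `Ω`. The spaces `L^p(Ω)` are taken with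
respect to this measure. -/
def normMeasure {d : ℕ} (Ω : Set (EuclideanSpace ℝ (Fin d))) :
    Measure (EuclideanSpace ℝ (Fin d)) :=
  (volume Ω)⁻¹ • volume.restrict Ω

/-- The space `C^∞(Ω)`: the smooth `L`-periodic functions `ℝ^d → ℂ`. -/
def smoothPeriodic {d : ℕ} (L : Submodule ℤ (EuclideanSpace ℝ (Fin d))) :
    Submodule ℂ (EuclideanSpace ℝ (Fin d) → ℂ) where
  carrier := {f | ContDiff ℝ ((⊤ : ℕ∞) : WithTop ℕ∞) f ∧ ∀ x, ∀ l ∈ L, f (x + l) = f x}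
  add_mem' := by
    rintro f g ⟨hf, hf'⟩ ⟨hg, hg'⟩
    exact ⟨hf.add hg, fun x l hl => by simp [hf' x l hl, hg' x l hl]⟩
  zero_mem' := ⟨contDiff_const, fun _ _ _ => rfl⟩
  smul_mem' := by
    rintro c f ⟨hf, hf'⟩
    exact ⟨contDiff_const.smul hf, fun x l hl => by simp [hf' x l hl]⟩

/-- The Fourier coefficient `|Ω|⁻¹ ∫_Ω f(x) e^{-2πi κ·x} dx`. -/
def fourierCoef {d : ℕ} (Ω : Set (EuclideanSpace ℝ (Fin d)))
    (f : EuclideanSpace ℝ (Fin d) → ℂ) (κ : EuclideanSpace ℝ (Fin d)) : ℂ :=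
  ∫ x, f x * Complex.exp (-(2 * Real.pi * Complex.I * (inner ℝ κ x : ℝ))) ∂(normMeasure Ω)

/-- `A : C^∞(Ω) → C^∞(Ω)` is a Fourier multiplier with symbol `σ`. Linearity of `A` is not part
of the definition. -/
def IsFourierMultiplier {d : ℕ} (L : Submodule ℤ (EuclideanSpace ℝ (Fin d)))
    (Ω : Set (EuclideanSpace ℝ (Fin d))) (A : smoothPeriodic L → smoothPeriodic L)
    (σ : dualLattice L → ℂ) : Prop :=
  ∀ (f : smoothPeriodic L) (κ : dualLattice L),
    fourierCoef Ω (A f : EuclideanSpace ℝ (Fin d) → ℂ) κ =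
      σ κ * fourierCoef Ω (f : EuclideanSpace ℝ (Fin d) → ℂ) κ

/-- `sup_{s > 0} s (#{κ ∈ L^⊥ : |σ(κ)| ≥ s})^{1/p - 1/q}`, as an element of `[0, ∞]`. -/
def symbolSup {d : ℕ} {L : Submodule ℤ (EuclideanSpace ℝ (Fin d))} (σ : dualLattice L → ℂ)
    (p q : ℝ≥0∞) : ℝ≥0∞ :=
  ⨆ (s : ℝ) (_ : 0 < s),
    ENNReal.ofReal s * (({κ | s ≤ ‖σ κ‖}.encard : ℕ∞) : ℝ≥0∞) ^ (1 / p.toReal - 1 / q.toReal)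

/-- `sup_{f ≠ 0} ‖A f‖_{L^q(Ω)} / ‖f‖_{L^p(Ω)}` over `f ∈ C^∞(Ω)`, as an element of `[0, ∞]`. -/
def smoothOpNorm {d : ℕ} {L : Submodule ℤ (EuclideanSpace ℝ (Fin d))}
    (Ω : Set (EuclideanSpace ℝ (Fin d))) (A : smoothPeriodic L → smoothPeriodic L)
    (p q : ℝ≥0∞) : ℝ≥0∞ :=
  ⨆ (f : smoothPeriodic L) (_ : f ≠ 0),
    eLpNorm (A f : EuclideanSpace ℝ (Fin d) → ℂ) q (normMeasure Ω) /
      eLpNorm (f : EuclideanSpace ℝ (Fin d) → ℂ) p (normMeasure Ω)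

end LatticeFourier

end

open LatticeFourier

/-! The heart is Paley's inequality: if `e` is an orthonormal system with `|e i| ≤ 1` and `v` is in
the unit ball of weak `ℓ^p`, `1 < p < 2`, then `∑ v_i^(2-p) |f̂(i)|² ≤ 2 / (p - 1) ‖f‖_p²`.
Normalize `‖f‖_p = 1`, write `v_i^(2-p)` as an integral over levels `s ≤ v_i`, and at level `s` cut
`f` at height `1 / s`. The low part obeys Bessel's inequality. The coefficients of the high part are
at most its `L¹` norm `N`, and weak `ℓ^p` bounds the number of indices concerned by `s^(-p)`; since
`N ≤ s^(p-1)`, the high part contributes at most `s^(-p) N² ≤ N / s`. Integrating either bound over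
`s` gives a multiple of `∫ |f|^p`. For `p = 2` the inequality is Bessel's.

For a multiplier, `u = |σ| / M` is in the unit ball of weak `ℓ^r`, where `1/r = 1/p - 1/q`. Test
`A f` against `h ∈ L^q'`. By Parseval and Cauchy–Schwarz the pairing is controlled by the Paley sums
of `f` and `h` with `v = u^(r/p)` and `v = u^(r/q')`, whose weights multiply to `u²` because
`1/p + 1/q' = 1 + 1/r`. Duality then bounds `‖A f‖_q`, with constant `2 √((q - 1) / (p - 1))`.

Parseval needs completeness of the exponentials. The projection to the torus `ℝ^d / L` is injective
on `Ω`, hence identifies `L^p(Ω)` with an `L^p` space of the torus, where the trigonometric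
polynomials are dense by Stone–Weierstrass. The same density gives the extension to `L^p(Ω)`, and
uniqueness of Fourier coefficients makes `A` linear. -/

noncomputable section

namespace LatticeFourier

open Set
open scoped FourierTransform

section LayerCake

theorem setLIntegral_Ioi_indicator_le_rpow {a : ℝ} (ha : 0 < a) {y : ℝ≥0∞} (hy : y ≠ ∞) :
    ∫⁻ s in Ioi (0 : ℝ), {s | ENNReal.ofReal s ≤ y}.indicator
      (fun s => ENNReal.ofReal s ^ (a - 1)) s = (ENNReal.ofReal a)⁻¹ * y ^ a := by
  lift y to ℝ≥0 using hy
  have hset : {s | ENNReal.ofReal s ≤ y} ∩ Ioi 0 = Ioc 0 (y : ℝ) := by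
    ext s
    simp [ENNReal.ofReal_le_iff_le_toReal, and_comm]
  have hint : IntegrableOn (fun s : ℝ => s ^ (a - 1)) (Ioc 0 (y : ℝ)) :=
    (intervalIntegrable_iff_integrableOn_Ioc_of_le y.coe_nonneg).1
      (intervalIntegral.intervalIntegrable_rpow' (by linarith))
  calc ∫⁻ s in Ioi (0 : ℝ), {s | ENNReal.ofReal s ≤ y}.indicator
        (fun s => ENNReal.ofReal s ^ (a - 1)) s
      = ∫⁻ s in Ioc 0 (y : ℝ), ENNReal.ofReal s ^ (a - 1) := by
        rw [setLIntegral_indicator (measurableSet_le (by fun_prop) (by fun_prop)), hset]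
    _ = ∫⁻ s in Ioc 0 (y : ℝ), ENNReal.ofReal (s ^ (a - 1)) :=
        setLIntegral_congr_fun measurableSet_Ioc fun s hs => ENNReal.ofReal_rpow_of_pos hs.1
    _ = ENNReal.ofReal ((y : ℝ) ^ a / a) := by
        rw [← ofReal_integral_eq_lintegral_ofReal hint
            (ae_restrict_of_forall_mem measurableSet_Ioc fun s hs => Real.rpow_nonneg hs.1.le _),
          ← intervalIntegral.integral_of_le y.coe_nonneg, integral_rpow (.inl (by linarith)),
          sub_add_cancel, Real.zero_rpow ha.ne', sub_zero]
    _ = (ENNReal.ofReal a)⁻¹ * (y : ℝ≥0∞) ^ a := by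
        rw [ENNReal.ofReal_div_of_pos ha, ← ENNReal.ofReal_rpow_of_nonneg y.coe_nonneg ha.le,
          ENNReal.ofReal_coe_nnreal, ENNReal.div_eq_inv_mul]

theorem setLIntegral_Ioi_indicator_lt_rpow {b : ℝ} (hb : 0 < b) {y : ℝ≥0∞} (hy₀ : y ≠ 0)
    (hy : y ≠ ∞) :
    ∫⁻ s in Ioi (0 : ℝ), {s | y < ENNReal.ofReal s}.indicator
      (fun s => ENNReal.ofReal s ^ (-b - 1)) s = (ENNReal.ofReal b)⁻¹ * y ^ (-b) := by
  lift y to ℝ≥0 using hy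
  have hy₀ : 0 < (y : ℝ) := by simpa [pos_iff_ne_zero] using hy₀
  have hset : {s | (y : ℝ≥0∞) < ENNReal.ofReal s} ∩ Ioi 0 = Ioi (y : ℝ) := by
    ext s
    simpa [ENNReal.lt_ofReal_iff_toReal_lt] using hy₀.trans
  calc ∫⁻ s in Ioi (0 : ℝ), {s | (y : ℝ≥0∞) < ENNReal.ofReal s}.indicator
        (fun s => ENNReal.ofReal s ^ (-b - 1)) s
      = ∫⁻ s in Ioi (y : ℝ), ENNReal.ofReal s ^ (-b - 1) := by
        rw [setLIntegral_indicator (measurableSet_lt (by fun_prop) (by fun_prop)), hset]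
    _ = ∫⁻ s in Ioi (y : ℝ), ENNReal.ofReal (s ^ (-b - 1)) :=
        setLIntegral_congr_fun measurableSet_Ioi fun s hs =>
          ENNReal.ofReal_rpow_of_pos (hy₀.trans hs)
    _ = ENNReal.ofReal ((y : ℝ) ^ (-b) / b) := by
        rw [← ofReal_integral_eq_lintegral_ofReal
            (integrableOn_Ioi_rpow_of_lt (by linarith) hy₀)
            (ae_restrict_of_forall_mem measurableSet_Ioi fun s hs =>
              Real.rpow_nonneg (hy₀.trans hs).le _),
          integral_Ioi_rpow_of_lt (by linarith) hy₀, sub_add_cancel, neg_div_neg_eq]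
    _ = (ENNReal.ofReal b)⁻¹ * (y : ℝ≥0∞) ^ (-b) := by
        rw [ENNReal.ofReal_div_of_pos hb, ← ENNReal.ofReal_rpow_of_pos hy₀,
          ENNReal.ofReal_coe_nnreal, ENNReal.div_eq_inv_mul]

theorem tsum_rpow_mul_le_lintegral {ι : Type*} {a : ℝ} (ha : 0 < a) {v : ι → ℝ≥0∞}
    (hv : ∀ i, v i ≠ ∞) (c : ι → ℝ≥0∞) :
    ∑' i, v i ^ a * c i ≤ ENNReal.ofReal a * ∫⁻ s in Ioi (0 : ℝ), ENNReal.ofReal s ^ (a - 1) *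
      ∑' i, {i | ENNReal.ofReal s ≤ v i}.indicator c i := by
  refine ENNReal.summable.tsum_le_of_sum_le fun t => ?_
  have hterm (i : ι) : v i ^ a * c i = ENNReal.ofReal a *
      ∫⁻ s in Ioi (0 : ℝ), ENNReal.ofReal s ^ (a - 1) *
        {i | ENNReal.ofReal s ≤ v i}.indicator c i := by
    have hind (s : ℝ) : ENNReal.ofReal s ^ (a - 1) *
        {i | ENNReal.ofReal s ≤ v i}.indicator c i =
        {s | ENNReal.ofReal s ≤ v i}.indicator (fun s => ENNReal.ofReal s ^ (a - 1)) s * c i := by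
      simp only [indicator_apply, mem_ofPred_eq, mul_ite, ite_mul, mul_zero, zero_mul]
    simp_rw [hind]
    rw [lintegral_mul_const _ (.indicator (by fun_prop)
        (measurableSet_le (by fun_prop) (by fun_prop))),
      setLIntegral_Ioi_indicator_le_rpow ha (hv i), mul_assoc, ← mul_assoc,
      ENNReal.mul_inv_cancel (by simpa) ENNReal.ofReal_ne_top, one_mul]
  have hmeas (i : ι) : Measurable fun s : ℝ => ENNReal.ofReal s ^ (a - 1) *
      {i | ENNReal.ofReal s ≤ v i}.indicator c i :=
    .mul (by fun_prop) ((measurable_const.indicator (measurableSet_le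
      ENNReal.measurable_ofReal (measurable_const (a := v i)))))
  simp_rw [hterm]
  rw [← Finset.mul_sum, ← lintegral_finsetSum _ fun i _ => hmeas i]
  gcongr with s
  rw [← Finset.mul_sum]
  gcongr
  exact ENNReal.sum_le_tsum t

variable {X : Type*} [MeasurableSpace X] {μ : Measure X} [SFinite μ] {φ : X → ℝ≥0∞}

theorem lintegral_mul_setLIntegral_swap {Y : Type*} [MeasurableSpace Y] {ν : Measure Y}
    [SFinite ν] {r : Y → X → Prop} (hr : NullMeasurableSet {z : Y × X | r z.1 z.2} (ν.prod μ))
    (hr₁ : ∀ x, NullMeasurableSet {y | r y x} ν) (hr₂ : ∀ y, NullMeasurableSet {x | r y x} μ)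
    {k : Y → ℝ≥0∞} (hk : AEMeasurable k ν) {g : X → ℝ≥0∞} (hg : AEMeasurable g μ) :
    ∫⁻ y, k y * ∫⁻ x in {x | r y x}, g x ∂μ ∂ν =
      ∫⁻ x, (∫⁻ y, {y | r y x}.indicator k y ∂ν) * g x ∂μ := by
  classical
  calc ∫⁻ y, k y * ∫⁻ x in {x | r y x}, g x ∂μ ∂ν
      = ∫⁻ y, ∫⁻ x, {z : Y × X | r z.1 z.2}.indicator (fun z => k z.1 * g z.2) (y, x) ∂μ ∂ν := by
        refine lintegral_congr fun y => ?_
        rw [← lintegral_indicator₀ (hr₂ y), ← lintegral_const_mul'' _ (hg.indicator₀ (hr₂ y))]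
        simp [indicator_apply]
    _ = ∫⁻ x, ∫⁻ y, {z : Y × X | r z.1 z.2}.indicator (fun z => k z.1 * g z.2) (y, x) ∂ν ∂μ :=
        lintegral_lintegral_swap ((hk.comp_fst.mul hg.comp_snd).indicator₀ hr)
    _ = ∫⁻ x, (∫⁻ y, {y | r y x}.indicator k y ∂ν) * g x ∂μ := by
        refine lintegral_congr fun x => ?_
        rw [← lintegral_mul_const'' _ (hk.indicator₀ (hr₁ x))]
        simp [indicator_apply]

theorem lintegral_rpow_mul_setLIntegral_le {a c : ℝ} (ha : 0 < a) (hac : a < c)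
    (hφ : AEMeasurable φ μ) (hφ' : ∀ x, φ x ≠ ∞) :
    ∫⁻ s in Ioi (0 : ℝ), ENNReal.ofReal s ^ (a - 1) *
        ∫⁻ x in {x | ENNReal.ofReal s * φ x ≤ 1}, φ x ^ c ∂μ =
      (ENNReal.ofReal a)⁻¹ * ∫⁻ x, φ x ^ (c - a) ∂μ := by
  have hpoint (x : X) : (∫⁻ s in Ioi (0 : ℝ), {s | ENNReal.ofReal s * φ x ≤ 1}.indicator
      (fun s => ENNReal.ofReal s ^ (a - 1)) s) * φ x ^ c =
        (ENNReal.ofReal a)⁻¹ * φ x ^ (c - a) := by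
    obtain h0 | h0 := eq_or_ne (φ x) 0
    · simp [h0, ENNReal.zero_rpow_of_pos (ha.trans hac), ENNReal.zero_rpow_of_pos (sub_pos.2 hac)]
    · simp_rw [← ENNReal.le_inv_iff_mul_le]
      rw [setLIntegral_Ioi_indicator_le_rpow ha (ENNReal.inv_ne_top.2 h0), mul_assoc,
        ENNReal.inv_rpow, ← ENNReal.rpow_neg, ← ENNReal.rpow_add _ _ h0 (hφ' x), neg_add_eq_sub]
  rw [lintegral_mul_setLIntegral_swap (r := fun s x => ENNReal.ofReal s * φ x ≤ 1)
    (nullMeasurableSet_le (by fun_prop) aemeasurable_const)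
    (fun x => nullMeasurableSet_le (by fun_prop) aemeasurable_const)
    (fun s => nullMeasurableSet_le (by fun_prop) aemeasurable_const) (by fun_prop) (by fun_prop),
    lintegral_congr hpoint]
  exact lintegral_const_mul'' _ (by fun_prop)

theorem lintegral_rpow_mul_setLIntegral_lt {b c : ℝ} (hb : 0 < b) (hc : 0 < c)
    (hφ : AEMeasurable φ μ) (hφ' : ∀ x, φ x ≠ ∞) :
    ∫⁻ s in Ioi (0 : ℝ), ENNReal.ofReal s ^ (-b - 1) *
        ∫⁻ x in {x | 1 < ENNReal.ofReal s * φ x}, φ x ^ c ∂μ =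
      (ENNReal.ofReal b)⁻¹ * ∫⁻ x, φ x ^ (c + b) ∂μ := by
  have hpoint (x : X) : (∫⁻ s in Ioi (0 : ℝ), {s | 1 < ENNReal.ofReal s * φ x}.indicator
      (fun s => ENNReal.ofReal s ^ (-b - 1)) s) * φ x ^ c =
        (ENNReal.ofReal b)⁻¹ * φ x ^ (c + b) := by
    obtain h0 | h0 := eq_or_ne (φ x) 0
    · simp [h0, ENNReal.zero_rpow_of_pos hc, ENNReal.zero_rpow_of_pos (add_pos hc hb)]
    · have hlt (s : ℝ) : 1 < ENNReal.ofReal s * φ x ↔ (φ x)⁻¹ < ENNReal.ofReal s := by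
        rw [← not_le, ← ENNReal.le_inv_iff_mul_le, not_le]
      simp_rw [hlt]
      rw [setLIntegral_Ioi_indicator_lt_rpow hb (ENNReal.inv_ne_zero.2 (hφ' x))
        (ENNReal.inv_ne_top.2 h0), mul_assoc, ENNReal.inv_rpow, ← ENNReal.rpow_neg, neg_neg,
        ← ENNReal.rpow_add _ _ h0 (hφ' x), add_comm]
  rw [lintegral_mul_setLIntegral_swap (r := fun s x => 1 < ENNReal.ofReal s * φ x)
    (nullMeasurableSet_lt aemeasurable_const (by fun_prop))
    (fun x => nullMeasurableSet_lt aemeasurable_const (by fun_prop))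
    (fun s => nullMeasurableSet_lt aemeasurable_const (by fun_prop)) (by fun_prop) (by fun_prop),
    lintegral_congr hpoint]
  exact lintegral_const_mul'' _ (by fun_prop)

theorem lintegral_rpow_mul_cut_eq {p : ℝ} (hp₁ : 1 < p) (hp₂ : p < 2)
    (hφ : AEMeasurable φ μ) (hφ' : ∀ x, φ x ≠ ∞) :
    ∫⁻ s in Ioi (0 : ℝ), ENNReal.ofReal s ^ (2 - p - 1) *
        (∫⁻ x in {x | ENNReal.ofReal s * φ x ≤ 1}, φ x ^ 2 ∂μ +
          (ENNReal.ofReal s)⁻¹ * ∫⁻ x in {x | 1 < ENNReal.ofReal s * φ x}, φ x ∂μ) =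
      ((ENNReal.ofReal (2 - p))⁻¹ + (ENNReal.ofReal (p - 1))⁻¹) * ∫⁻ x, φ x ^ p ∂μ := by
  have hlow := lintegral_rpow_mul_setLIntegral_le (c := 2) (sub_pos.2 hp₂) (by linarith) hφ hφ'
  have hhigh := lintegral_rpow_mul_setLIntegral_lt (sub_pos.2 hp₁) one_pos hφ hφ'
  simp only [sub_sub_cancel, ENNReal.rpow_two, add_sub_cancel, ENNReal.rpow_one] at hlow hhigh
  have hmeas : Measurable fun s : ℝ =>
      ∫⁻ x in {x | ENNReal.ofReal s * φ x ≤ 1}, φ x ^ 2 ∂μ := by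
    refine Antitone.measurable fun s t hst => lintegral_mono_set fun x hx => ?_
    exact le_trans (by gcongr) (mem_ofPred.1 hx)
  calc _ = ∫⁻ s in Ioi (0 : ℝ), (ENNReal.ofReal s ^ (2 - p - 1) *
            ∫⁻ x in {x | ENNReal.ofReal s * φ x ≤ 1}, φ x ^ 2 ∂μ +
          ENNReal.ofReal s ^ (-(p - 1) - 1) *
            ∫⁻ x in {x | 1 < ENNReal.ofReal s * φ x}, φ x ∂μ) := by
        refine setLIntegral_congr_fun measurableSet_Ioi fun s hs => ?_
        rw [show -(p - 1) - 1 = 2 - p - 1 + -1 by ring, ENNReal.rpow_add _ _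
          (ENNReal.ofReal_pos.2 hs).ne' ENNReal.ofReal_ne_top, ENNReal.rpow_neg_one, mul_add,
          mul_assoc]
    _ = _ := by
        rw [lintegral_add_left (by fun_prop), hlow, hhigh, add_mul]

end LayerCake

section Bessel

variable {X ι 𝕜 : Type*} [MeasurableSpace X] {μ : Measure X} [RCLike 𝕜] {e : ι → Lp 𝕜 2 μ}
  {f g : X → 𝕜}

/-- The coefficients of `f` with respect to a system `e` in `L²`. They are written as an integral,
not as an inner product in `L²`, because they are also needed for `f` which is merely integrable;
the integral converges then if `e` is bounded. -/
def coeff (e : ι → Lp 𝕜 2 μ) (f : X → 𝕜) (i : ι) : 𝕜 :=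
  ∫ x, f x * starRingEnd 𝕜 (e i x) ∂μ

theorem coeff_eq_inner (hf : MemLp f 2 μ) (i : ι) :
    coeff e f i = inner 𝕜 (e i) (hf.toLp f) := by
  rw [coeff, L2.inner_def]
  refine integral_congr_ae ?_
  filter_upwards [hf.coeFn_toLp] with x hx
  rw [hx, RCLike.inner_apply]

theorem integrable_mul_conj (he : ∀ i, ∀ᵐ x ∂μ, ‖e i x‖ ≤ 1) (hf : Integrable f μ) (i : ι) :
    Integrable (fun x => f x * starRingEnd 𝕜 (e i x)) μ :=
  hf.mul_bdd (c := 1) (RCLike.continuous_conj.comp_aestronglyMeasurable (Lp.aestronglyMeasurable _))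
    (by simpa only [RCLike.norm_conj] using he i)

theorem coeff_add (he : ∀ i, ∀ᵐ x ∂μ, ‖e i x‖ ≤ 1) (hf : Integrable f μ) (hg : Integrable g μ)
    (i : ι) : coeff e (f + g) i = coeff e f i + coeff e g i := by
  simp only [coeff, Pi.add_apply, add_mul]
  exact integral_add (integrable_mul_conj he hf i) (integrable_mul_conj he hg i)

theorem coeff_smul (c : 𝕜) (f : X → 𝕜) (i : ι) : coeff e (c • f) i = c * coeff e f i := by
  simp only [coeff, Pi.smul_apply, smul_eq_mul, mul_assoc, integral_const_mul]

theorem enorm_coeff_le (he : ∀ i, ∀ᵐ x ∂μ, ‖e i x‖ ≤ 1) (f : X → 𝕜) (i : ι) :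
    ‖coeff e f i‖ₑ ≤ ∫⁻ x, ‖f x‖ₑ ∂μ := by
  refine (enorm_integral_le_lintegral_enorm _).trans (lintegral_mono_ae ?_)
  filter_upwards [he i] with x hx
  rw [enorm_mul, RCLike.enorm_conj]
  exact mul_le_of_le_one_right' (by rwa [← ofReal_norm, ENNReal.ofReal_le_one])

theorem tsum_enorm_coeff_sq_le (he : Orthonormal 𝕜 e) (hf : AEStronglyMeasurable f μ) :
    ∑' i, ‖coeff e f i‖ₑ ^ 2 ≤ ∫⁻ x, ‖f x‖ₑ ^ 2 ∂μ := by
  obtain htop | hfin := eq_or_ne (∫⁻ x, ‖f x‖ₑ ^ 2 ∂μ) ∞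
  · exact htop ▸ le_top
  have hf₂ : MemLp f 2 μ := ⟨hf, by
    rw [eLpNorm_lt_top_iff_lintegral_rpow_enorm_lt_top two_ne_zero ENNReal.ofNat_ne_top]
    simpa using hfin.lt_top⟩
  have hnorm : ‖hf₂.toLp f‖ₑ ^ 2 = ∫⁻ x, ‖f x‖ₑ ^ 2 ∂μ := by
    rw [Lp.enorm_toLp, eLpNorm_eq_lintegral_rpow_enorm_toReal two_ne_zero ENNReal.ofNat_ne_top,
      ← ENNReal.rpow_natCast, ← ENNReal.rpow_mul]
    simp
  refine ENNReal.summable.tsum_le_of_sum_le fun t => ?_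
  simp_rw [coeff_eq_inner hf₂, ← hnorm, ← ofReal_norm, ← ENNReal.ofReal_pow (norm_nonneg _)]
  rw [← ENNReal.ofReal_sum_of_nonneg fun _ _ => sq_nonneg _]
  exact ENNReal.ofReal_le_ofReal (he.sum_inner_products_le _)

theorem tsum_indicator_enorm_coeff_sq_le (he : Orthonormal 𝕜 e) (hb : ∀ i, ∀ᵐ x ∂μ, ‖e i x‖ ≤ 1)
    (hf : Integrable f μ) {S : Set X} (hS : NullMeasurableSet S μ) (E : Set ι) :
    ∑' i, E.indicator (fun i => ‖coeff e f i‖ₑ ^ 2) i ≤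
      2 * (∫⁻ x in S, ‖f x‖ₑ ^ 2 ∂μ + E.encard * (∫⁻ x in Sᶜ, ‖f x‖ₑ ∂μ) ^ 2) := by
  have hlow : ∑' i, ‖coeff e (S.indicator f) i‖ₑ ^ 2 ≤ ∫⁻ x in S, ‖f x‖ₑ ^ 2 ∂μ := by
    rw [← lintegral_indicator₀ hS]
    refine (tsum_enorm_coeff_sq_le he (hf.1.indicator₀ hS)).trans_eq (lintegral_congr fun x => ?_)
    by_cases hx : x ∈ S <;> simp [hx]
  have hhigh (i : ι) : ‖coeff e (Sᶜ.indicator f) i‖ₑ ≤ ∫⁻ x in Sᶜ, ‖f x‖ₑ ∂μ := by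
    rw [← lintegral_indicator₀ hS.compl]
    refine (enorm_coeff_le hb _ i).trans_eq (lintegral_congr fun x => ?_)
    exact enorm_indicator_eq_indicator_enorm _ _
  have hterm (i : ι) : ‖coeff e f i‖ₑ ^ 2 ≤
      2 * (‖coeff e (S.indicator f) i‖ₑ ^ 2 + (∫⁻ x in Sᶜ, ‖f x‖ₑ ∂μ) ^ 2) := by
    calc ‖coeff e f i‖ₑ ^ 2
        = ‖coeff e (S.indicator f) i + coeff e (Sᶜ.indicator f) i‖ₑ ^ 2 := by
          rw [← coeff_add hb (hf.indicator₀ hS) (hf.indicator₀ hS.compl),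
            Set.indicator_self_add_compl]
      _ ≤ (‖coeff e (S.indicator f) i‖ₑ + ∫⁻ x in Sᶜ, ‖f x‖ₑ ∂μ) ^ 2 := by
          gcongr
          exact (enorm_add_le _ _).trans (by gcongr; exact hhigh i)
      _ ≤ 2 * (‖coeff e (S.indicator f) i‖ₑ ^ 2 + (∫⁻ x in Sᶜ, ‖f x‖ₑ ∂μ) ^ 2) := by
          simpa [show (2 : ℝ) - 1 = 1 by norm_num] using ENNReal.rpow_add_le_mul_rpow_add_rpow
            ‖coeff e (S.indicator f) i‖ₑ (∫⁻ x in Sᶜ, ‖f x‖ₑ ∂μ) one_le_two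
  calc ∑' i, E.indicator (fun i => ‖coeff e f i‖ₑ ^ 2) i
      ≤ ∑' i, 2 * (‖coeff e (S.indicator f) i‖ₑ ^ 2 +
          E.indicator (fun _ => (∫⁻ x in Sᶜ, ‖f x‖ₑ ∂μ) ^ 2) i) := by
        refine ENNReal.tsum_le_tsum fun i => ?_
        by_cases hi : i ∈ E
        · simpa only [indicator_of_mem hi] using hterm i
        · simp [hi]
    _ = 2 * (∑' i, ‖coeff e (S.indicator f) i‖ₑ ^ 2 +
          E.encard * (∫⁻ x in Sᶜ, ‖f x‖ₑ ∂μ) ^ 2) := by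
        rw [ENNReal.tsum_mul_left, ENNReal.tsum_add, ← tsum_subtype, ENNReal.tsum_const]
        rfl
    _ ≤ _ := by gcongr

end Bessel

section WeakUnitBall

variable {ι : Type*} {r : ℝ} {u : ι → ℝ≥0∞}

/-- The unit ball of the weak space `ℓ^{r,∞}`: the families of which at most `s⁻ʳ` members are
`≥ s`, for every `s`. -/
def weakUnitBall (ι : Type*) (r : ℝ) : Set (ι → ℝ≥0∞) :=
  {u | ∀ s : ℝ≥0∞, ({i | s ≤ u i}.encard : ℝ≥0∞) ≤ s ^ (-r)}

theorem le_one_of_mem_weakUnitBall (hr : 0 < r) (hu : u ∈ weakUnitBall ι r) (i : ι) :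
    u i ≤ 1 := by
  have hone : (1 : ℝ≥0∞) ≤ ({j | u i ≤ u j}.encard : ℝ≥0∞) := by
    exact_mod_cast Set.one_le_encard_iff_nonempty.2 ⟨i, le_refl (u i)⟩
  by_contra! h
  exact ((hone.trans (hu (u i))).trans_lt (ENNReal.rpow_lt_one_of_one_lt_of_neg h (by simpa))).false

theorem rpow_mem_weakUnitBall (hr : 0 < r) {p : ℝ} (hp : 0 < p) (hu : u ∈ weakUnitBall ι r) :
    (fun i => u i ^ (r / p)) ∈ weakUnitBall ι p := by
  intro s
  have hiff (i : ι) : s ≤ u i ^ (r / p) ↔ s ^ (p / r) ≤ u i := by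
    rw [← inv_div p r, ENNReal.le_rpow_inv_iff (div_pos hp hr)]
  simp only [hiff]
  refine (hu _).trans_eq ?_
  rw [← ENNReal.rpow_mul, mul_neg, div_mul_cancel₀ p hr.ne']

end WeakUnitBall

section Paley

variable {X ι 𝕜 : Type*} [MeasurableSpace X] {μ : Measure X} [RCLike 𝕜] {e : ι → Lp 𝕜 2 μ}
  {f : X → 𝕜} {p : ℝ} {v : ι → ℝ≥0∞}

theorem setLIntegral_enorm_lt_le_rpow (hp : 1 < p) (hf : AEStronglyMeasurable f μ)
    (hf₁ : ∫⁻ x, ‖f x‖ₑ ^ p ∂μ ≤ 1) {θ : ℝ≥0∞} (hθ : θ ≠ ∞) :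
    ∫⁻ x in {x | 1 < θ * ‖f x‖ₑ}, ‖f x‖ₑ ∂μ ≤ θ ^ (p - 1) := by
  have hpoint (x : X) (hx : 1 < θ * ‖f x‖ₑ) : ‖f x‖ₑ ≤ θ ^ (p - 1) * ‖f x‖ₑ ^ p := by
    have hfx : ‖f x‖ₑ ≠ 0 := right_ne_zero_of_mul (zero_lt_one.trans hx).ne'
    calc ‖f x‖ₑ = 1 ^ (p - 1) * ‖f x‖ₑ := by rw [ENNReal.one_rpow, one_mul]
      _ ≤ (θ * ‖f x‖ₑ) ^ (p - 1) * ‖f x‖ₑ := by gcongr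
      _ = θ ^ (p - 1) * (‖f x‖ₑ ^ (p - 1) * ‖f x‖ₑ ^ (1 : ℝ)) := by
        rw [ENNReal.mul_rpow_of_ne_top hθ enorm_ne_top, ENNReal.rpow_one, mul_assoc]
      _ = θ ^ (p - 1) * ‖f x‖ₑ ^ p := by
        rw [← ENNReal.rpow_add _ _ hfx enorm_ne_top, sub_add_cancel]
  have hS : NullMeasurableSet {x | 1 < θ * ‖f x‖ₑ} μ :=
    nullMeasurableSet_lt aemeasurable_const (hf.enorm.const_mul θ)
  calc ∫⁻ x in {x | 1 < θ * ‖f x‖ₑ}, ‖f x‖ₑ ∂μ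
      ≤ ∫⁻ x in {x | 1 < θ * ‖f x‖ₑ}, θ ^ (p - 1) * ‖f x‖ₑ ^ p ∂μ :=
        lintegral_mono_ae ((ae_restrict_mem₀ hS).mono hpoint)
    _ ≤ ∫⁻ x, θ ^ (p - 1) * ‖f x‖ₑ ^ p ∂μ := setLIntegral_le_lintegral _ _
    _ = θ ^ (p - 1) * ∫⁻ x, ‖f x‖ₑ ^ p ∂μ := lintegral_const_mul'' _ (hf.enorm.pow_const p)
    _ ≤ θ ^ (p - 1) := mul_le_of_le_one_right' hf₁

theorem tsum_indicator_level_enorm_coeff_sq_le (he : Orthonormal 𝕜 e)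
    (hb : ∀ i, ∀ᵐ x ∂μ, ‖e i x‖ ≤ 1) (hp : 1 < p) (hv : v ∈ weakUnitBall ι p)
    (hf : Integrable f μ) (hf₁ : ∫⁻ x, ‖f x‖ₑ ^ p ∂μ ≤ 1) {θ : ℝ≥0∞} (hθ₀ : θ ≠ 0) (hθ : θ ≠ ∞) :
    ∑' i, {i | θ ≤ v i}.indicator (fun i => ‖coeff e f i‖ₑ ^ 2) i ≤
      2 * (∫⁻ x in {x | θ * ‖f x‖ₑ ≤ 1}, ‖f x‖ₑ ^ 2 ∂μ +
        θ⁻¹ * ∫⁻ x in {x | 1 < θ * ‖f x‖ₑ}, ‖f x‖ₑ ∂μ) := by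
  have hS : NullMeasurableSet {x | θ * ‖f x‖ₑ ≤ 1} μ :=
    nullMeasurableSet_le (hf.1.enorm.const_mul θ) aemeasurable_const
  refine (tsum_indicator_enorm_coeff_sq_le he hb hf hS _).trans ?_
  have hcompl : {x | θ * ‖f x‖ₑ ≤ 1}ᶜ = {x | 1 < θ * ‖f x‖ₑ} := by
    ext x
    simp
  rw [hcompl]
  gcongr 2 * (_ + ?_)
  calc ({i | θ ≤ v i}.encard : ℝ≥0∞) * (∫⁻ x in {x | 1 < θ * ‖f x‖ₑ}, ‖f x‖ₑ ∂μ) ^ 2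
      ≤ θ ^ (-p) * (θ ^ (p - 1) * ∫⁻ x in {x | 1 < θ * ‖f x‖ₑ}, ‖f x‖ₑ ∂μ) := by
        rw [sq]
        gcongr
        exacts [hv θ, setLIntegral_enorm_lt_le_rpow hp hf.1 hf₁ hθ]
    _ = θ⁻¹ * ∫⁻ x in {x | 1 < θ * ‖f x‖ₑ}, ‖f x‖ₑ ∂μ := by
        rw [← mul_assoc, ← ENNReal.rpow_add _ _ hθ₀ hθ, ← ENNReal.rpow_neg_one]
        ring_nf

theorem tsum_rpow_mul_enorm_coeff_sq_le_of_lintegral_le_one [SFinite μ] (he : Orthonormal 𝕜 e)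
    (hb : ∀ i, ∀ᵐ x ∂μ, ‖e i x‖ ≤ 1) (hp₁ : 1 < p) (hp₂ : p < 2) (hv : v ∈ weakUnitBall ι p)
    (hf : Integrable f μ) (hf₁ : ∫⁻ x, ‖f x‖ₑ ^ p ∂μ ≤ 1) :
    ∑' i, v i ^ (2 - p) * ‖coeff e f i‖ₑ ^ 2 ≤ ENNReal.ofReal (2 / (p - 1)) := by
  have ha : 0 < 2 - p := sub_pos.2 hp₂
  have hc : 0 < p - 1 := sub_pos.2 hp₁
  have hv' (i : ι) : v i ≠ ∞ :=
    ne_top_of_le_ne_top ENNReal.one_ne_top (le_one_of_mem_weakUnitBall (zero_lt_one.trans hp₁) hv i)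
  calc ∑' i, v i ^ (2 - p) * ‖coeff e f i‖ₑ ^ 2
      ≤ ENNReal.ofReal (2 - p) * ∫⁻ s in Ioi (0 : ℝ), ENNReal.ofReal s ^ (2 - p - 1) *
          ∑' i, {i | ENNReal.ofReal s ≤ v i}.indicator (fun i => ‖coeff e f i‖ₑ ^ 2) i :=
        tsum_rpow_mul_le_lintegral ha hv' _
    _ ≤ ENNReal.ofReal (2 - p) * ∫⁻ s in Ioi (0 : ℝ), 2 * (ENNReal.ofReal s ^ (2 - p - 1) *
          (∫⁻ x in {x | ENNReal.ofReal s * ‖f x‖ₑ ≤ 1}, ‖f x‖ₑ ^ 2 ∂μ +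
            (ENNReal.ofReal s)⁻¹ * ∫⁻ x in {x | 1 < ENNReal.ofReal s * ‖f x‖ₑ}, ‖f x‖ₑ ∂μ)) := by
        gcongr 1
        refine setLIntegral_mono' measurableSet_Ioi fun s hs => ?_
        rw [mul_left_comm 2]
        exact mul_right_mono (tsum_indicator_level_enorm_coeff_sq_le he hb hp₁ hv hf hf₁
          (ENNReal.ofReal_pos.2 hs).ne' ENNReal.ofReal_ne_top)
    _ = ENNReal.ofReal (2 - p) * (2 * (((ENNReal.ofReal (2 - p))⁻¹ +
          (ENNReal.ofReal (p - 1))⁻¹) * ∫⁻ x, ‖f x‖ₑ ^ p ∂μ)) := by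
        rw [lintegral_const_mul' _ _ ENNReal.ofNat_ne_top,
          lintegral_rpow_mul_cut_eq hp₁ hp₂ hf.1.enorm fun _ => enorm_ne_top]
    _ ≤ ENNReal.ofReal (2 - p) *
          (2 * (((ENNReal.ofReal (2 - p))⁻¹ + (ENNReal.ofReal (p - 1))⁻¹) * 1)) := by gcongr
    _ = ENNReal.ofReal (2 / (p - 1)) := by
        rw [mul_one, ← ENNReal.ofReal_inv_of_pos ha, ← ENNReal.ofReal_inv_of_pos hc,
          ← ENNReal.ofReal_ofNat, ← ENNReal.ofReal_add (by positivity) (by positivity),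
          ← ENNReal.ofReal_mul zero_le_two, ← ENNReal.ofReal_mul ha.le]
        congr 1
        field_simp
        ring

theorem tsum_rpow_mul_enorm_coeff_sq_le [SFinite μ] (he : Orthonormal 𝕜 e)
    (hb : ∀ i, ∀ᵐ x ∂μ, ‖e i x‖ ≤ 1) (hp₁ : 1 < p) (hp₂ : p ≤ 2) (hv : v ∈ weakUnitBall ι p)
    (hf : Integrable f μ) :
    ∑' i, v i ^ (2 - p) * ‖coeff e f i‖ₑ ^ 2 ≤
      ENNReal.ofReal (2 / (p - 1)) * eLpNorm' f p μ ^ 2 := by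
  obtain rfl | hp₂ := hp₂.eq_or_lt
  · calc ∑' i, v i ^ (2 - 2 : ℝ) * ‖coeff e f i‖ₑ ^ 2
        = ∑' i, ‖coeff e f i‖ₑ ^ 2 := by simp only [sub_self, ENNReal.rpow_zero, one_mul]
      _ ≤ ∫⁻ x, ‖f x‖ₑ ^ 2 ∂μ := tsum_enorm_coeff_sq_le he hf.1
      _ = eLpNorm' f 2 μ ^ 2 := by
        simpa using lintegral_rpow_enorm_eq_rpow_eLpNorm' (f := f) (μ := μ) zero_lt_two
      _ ≤ ENNReal.ofReal (2 / (2 - 1)) * eLpNorm' f 2 μ ^ 2 :=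
        le_mul_of_one_le_left' (by norm_num)
  have hp₀ : 0 < p := by linarith
  obtain h0 | h0 := eq_or_ne (eLpNorm' f p μ) 0
  · have hf₀ : f =ᵐ[μ] 0 := (eLpNorm'_eq_zero_iff hp₀ hf.1).1 h0
    have hcoeff (i : ι) : coeff e f i = 0 :=
      integral_eq_zero_of_ae (hf₀.mono fun x hx => by simp [hx])
    simp [hcoeff]
  obtain htop | htop := eq_or_ne (eLpNorm' f p μ) ∞
  · simp [htop, hp₁]
  set N := eLpNorm' f p μ
  have hc : ‖((N⁻¹).toReal : 𝕜)‖ₑ = N⁻¹ := by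
    rw [← ofReal_norm, RCLike.norm_ofReal, abs_of_nonneg ENNReal.toReal_nonneg,
      ENNReal.ofReal_toReal (ENNReal.inv_ne_top.2 h0)]
  have hunit : ∫⁻ x, ‖(((N⁻¹).toReal : 𝕜) • f) x‖ₑ ^ p ∂μ ≤ 1 := by
    rw [lintegral_rpow_enorm_eq_rpow_eLpNorm' hp₀, eLpNorm'_const_smul _ hp₀, hc,
      ENNReal.inv_mul_cancel h0 htop, ENNReal.one_rpow]
  have hscaled := tsum_rpow_mul_enorm_coeff_sq_le_of_lintegral_le_one he hb hp₁ hp₂ hv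
    (hf.smul _) hunit
  simp only [coeff_smul, enorm_mul, hc, mul_pow, mul_left_comm _ (N⁻¹ ^ 2)] at hscaled
  rwa [ENNReal.tsum_mul_left, ← ENNReal.inv_pow, ENNReal.inv_mul_le_iff (pow_ne_zero 2 h0)
    (ENNReal.pow_ne_top htop), mul_comm] at hscaled

end Paley

section Multiplier

variable {X ι 𝕜 : Type*} [MeasurableSpace X] {μ : Measure X} [RCLike 𝕜]

theorem tsum_mul_sq_le (a b : ι → ℝ≥0∞) :
    (∑' i, a i * b i) ^ 2 ≤ (∑' i, a i ^ 2) * ∑' i, b i ^ 2 := by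
  have hle : ∑' i, a i * b i ≤
      (∑' i, a i ^ 2) ^ (1 / 2 : ℝ) * (∑' i, b i ^ 2) ^ (1 / 2 : ℝ) := by
    refine ENNReal.summable.tsum_le_of_sum_le fun t => ?_
    refine (ENNReal.inner_le_Lp_mul_Lq t a b .two_two).trans ?_
    simp only [ENNReal.rpow_two]
    gcongr <;> exact ENNReal.sum_le_tsum t
  refine (pow_le_pow_left' hle 2).trans_eq ?_
  simp only [mul_pow, ← ENNReal.rpow_mul_natCast]
  norm_num

theorem tsum_mul_enorm_coeff_mul_enorm_coeff_sq_le [SFinite μ] {e : ι → Lp 𝕜 2 μ}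
    (he : Orthonormal 𝕜 e) (hb : ∀ i, ∀ᵐ x ∂μ, ‖e i x‖ ≤ 1) {p q r : ℝ} (hp₁ : 1 < p)
    (hp₂ : p ≤ 2) (hq₁ : 1 < q) (hq₂ : q ≤ 2) (hr : 0 < r) (hpqr : p⁻¹ + q⁻¹ = 1 + r⁻¹)
    {u : ι → ℝ≥0∞} (hu : u ∈ weakUnitBall ι r) {f g : X → 𝕜} (hf : Integrable f μ)
    (hg : Integrable g μ) :
    (∑' i, u i * ‖coeff e f i‖ₑ * ‖coeff e g i‖ₑ) ^ 2 ≤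
      ENNReal.ofReal (2 / (p - 1)) * eLpNorm' f p μ ^ 2 *
        (ENNReal.ofReal (2 / (q - 1)) * eLpNorm' g q μ ^ 2) := by
  have hpaley {p : ℝ} (hp₁ : 1 < p) (hp₂ : p ≤ 2) {f : X → 𝕜} (hf : Integrable f μ) :
      ∑' i, (u i ^ (r / p * (2 - p) / 2) * ‖coeff e f i‖ₑ) ^ 2 ≤
        ENNReal.ofReal (2 / (p - 1)) * eLpNorm' f p μ ^ 2 := by
    have hp₀ : 0 < p := zero_lt_one.trans hp₁
    convert tsum_rpow_mul_enorm_coeff_sq_le he hb hp₁ hp₂ (rpow_mem_weakUnitBall hr hp₀ hu) hf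
      using 3 with i
    rw [mul_pow, ← ENNReal.rpow_mul_natCast, ← ENNReal.rpow_mul]
    norm_num
  have hsplit (i : ι) : u i = u i ^ (r / p * (2 - p) / 2) * u i ^ (r / q * (2 - q) / 2) := by
    have hsum : r / p * (2 - p) / 2 + r / q * (2 - q) / 2 = r * (p⁻¹ + q⁻¹ - 1) := by
      field_simp
      ring
    rw [← ENNReal.rpow_add_of_nonneg, hsum, hpqr, add_sub_cancel_left, mul_inv_cancel₀ hr.ne',
      ENNReal.rpow_one]
    · have := sub_nonneg.2 hp₂
      positivity
    · have := sub_nonneg.2 hq₂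
      positivity
  calc (∑' i, u i * ‖coeff e f i‖ₑ * ‖coeff e g i‖ₑ) ^ 2
      = (∑' i, u i ^ (r / p * (2 - p) / 2) * ‖coeff e f i‖ₑ *
          (u i ^ (r / q * (2 - q) / 2) * ‖coeff e g i‖ₑ)) ^ 2 := by
        congr 2 with i
        nth_rw 1 [hsplit i]
        ring
    _ ≤ _ := tsum_mul_sq_le _ _
    _ ≤ _ := mul_le_mul' (hpaley hp₁ hp₂ hf) (hpaley hq₁ hq₂ hg)

theorem enorm_integral_mul_conj_le_tsum (e : HilbertBasis ι 𝕜 (Lp 𝕜 2 μ)) {g h : X → 𝕜}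
    (hg : MemLp g 2 μ) (hh : MemLp h 2 μ) :
    ‖∫ x, g x * starRingEnd 𝕜 (h x) ∂μ‖ₑ ≤ ∑' i, ‖coeff e g i‖ₑ * ‖coeff e h i‖ₑ := by
  have hinner : ∫ x, g x * starRingEnd 𝕜 (h x) ∂μ = inner 𝕜 (hh.toLp h) (hg.toLp g) := by
    rw [L2.inner_def]
    refine integral_congr_ae ?_
    filter_upwards [hg.coeFn_toLp, hh.coeFn_toLp] with x hgx hhx
    rw [hgx, hhx, RCLike.inner_apply]
  rw [hinner, ← e.tsum_inner_mul_inner]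
  refine enorm_tsum_le_tsum_enorm.trans_eq (tsum_congr fun i => ?_)
  rw [coeff_eq_inner hg, coeff_eq_inner hh, enorm_mul, mul_comm,
    ← inner_conj_symm (hh.toLp h), RCLike.enorm_conj]

theorem exists_memLp_enorm_integral_mul_conj_eq [IsFiniteMeasure μ] {q q' : ℝ}
    (hq : q.HolderConjugate q') {g : X → 𝕜} (hg : MemLp g ∞ μ) :
    ∃ h : X → 𝕜, MemLp h ∞ μ ∧ eLpNorm' h q' μ = (∫⁻ x, ‖g x‖ₑ ^ q ∂μ) ^ q'⁻¹ ∧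
      ‖∫ x, g x * starRingEnd 𝕜 (h x) ∂μ‖ₑ = ∫⁻ x, ‖g x‖ₑ ^ q ∂μ := by
  -- The extremizer of Hölder's inequality for `g`.
  set h : X → 𝕜 := fun x => ((‖g x‖ ^ (q - 2) : ℝ) : 𝕜) * g x
  have hnorm (x : X) : ‖h x‖ = ‖g x‖ ^ (q - 1) := by
    obtain h0 | h0 := eq_or_ne (g x) 0
    · simp [h, h0, Real.zero_rpow hq.sub_one_ne_zero]
    · rw [norm_mul, RCLike.norm_ofReal, abs_of_nonneg (by positivity),
        ← Real.rpow_add_one (norm_ne_zero_iff.2 h0)]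
      ring_nf
  have hmul (x : X) : g x * starRingEnd 𝕜 (h x) = ((‖g x‖ ^ q : ℝ) : 𝕜) := by
    obtain h0 | h0 := eq_or_ne (g x) 0
    · simp [h0, Real.zero_rpow hq.ne_zero]
    · rw [map_mul, RCLike.conj_ofReal, mul_left_comm, RCLike.mul_conj, ← RCLike.ofReal_pow,
        ← RCLike.ofReal_mul, ← Real.rpow_add_natCast (norm_ne_zero_iff.2 h0)]
      norm_num
  have hmeas : AEStronglyMeasurable h μ :=
    (RCLike.continuous_ofReal.comp_aestronglyMeasurable
      (hg.1.norm.aemeasurable.pow_const _).aestronglyMeasurable).mul hg.1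
  have hpow {y : ℝ} (hy : 0 ≤ y) : MemLp (fun x => ‖g x‖ ^ y) ∞ μ := by
    simpa only [ENNReal.top_div_of_ne_top ENNReal.ofReal_ne_top, ENNReal.toReal_ofReal hy] using
      hg.norm_rpow_div (ENNReal.ofReal y)
  have henorm {y : ℝ} (hy : 0 ≤ y) (x : X) : ENNReal.ofReal (‖g x‖ ^ y) = ‖g x‖ₑ ^ y := by
    rw [← ENNReal.ofReal_rpow_of_nonneg (norm_nonneg _) hy, ofReal_norm]
  refine ⟨h, (hpow hq.sub_one_pos.le).congr_norm hmeas (.of_forall fun x => ?_), ?_, ?_⟩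
  · rw [hnorm, Real.norm_of_nonneg (by positivity)]
  · simp_rw [eLpNorm'_eq_lintegral_enorm, ← ofReal_norm (h _), hnorm, henorm hq.sub_one_pos.le,
      ← ENNReal.rpow_mul, hq.sub_one_mul_conj, one_div]
  · have hnonneg (x : X) : 0 ≤ ‖g x‖ ^ q := by positivity
    simp_rw [hmul]
    rw [integral_ofReal, ← ofReal_norm, RCLike.norm_ofReal, abs_of_nonneg (integral_nonneg hnonneg),
      ofReal_integral_eq_lintegral_ofReal _ (.of_forall hnonneg)]
    · simp_rw [henorm hq.nonneg]
    · exact (hpow hq.nonneg).integrable le_top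

theorem eLpNorm'_le_of_forall_enorm_integral_mul_conj_le [IsFiniteMeasure μ] {q q' : ℝ}
    (hq : q.HolderConjugate q') {g : X → 𝕜} (hg : MemLp g ∞ μ) {B : ℝ≥0∞}
    (hB : ∀ h : X → 𝕜, MemLp h ∞ μ →
      ‖∫ x, g x * starRingEnd 𝕜 (h x) ∂μ‖ₑ ≤ B * eLpNorm' h q' μ) :
    eLpNorm' g q μ ≤ B := by
  obtain ⟨h, hh, hnorm, hint⟩ := exists_memLp_enorm_integral_mul_conj_eq hq hg
  have hJ : ∫⁻ x, ‖g x‖ₑ ^ q ∂μ ≠ ∞ := hint ▸ enorm_ne_top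
  have hle := hB h hh
  rw [hint, hnorm] at hle
  rw [eLpNorm'_eq_lintegral_enorm, one_div]
  set J := ∫⁻ x, ‖g x‖ₑ ^ q ∂μ
  obtain h0 | h0 := eq_or_ne J 0
  · simp [h0, ENNReal.zero_rpow_of_pos (inv_pos.2 hq.pos)]
  calc J ^ q⁻¹ = J ^ (1 : ℝ) * J ^ (-q'⁻¹) := by
        rw [← ENNReal.rpow_add _ _ h0 hJ, ← hq.inv_add_inv_eq_one, add_neg_cancel_right]
    _ ≤ B * J ^ q'⁻¹ * J ^ (-q'⁻¹) := by gcongr; rwa [ENNReal.rpow_one]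
    _ = B := by
        rw [mul_assoc, ← ENNReal.rpow_add _ _ h0 hJ, add_neg_cancel, ENNReal.rpow_zero, mul_one]

theorem eLpNorm'_le_of_enorm_coeff_le [IsFiniteMeasure μ] (e : HilbertBasis ι 𝕜 (Lp 𝕜 2 μ))
    (hb : ∀ i, ∀ᵐ x ∂μ, ‖e i x‖ ≤ 1) {p q : ℝ} (hp₁ : 1 < p) (hp₂ : p ≤ 2) (hq : 2 ≤ q)
    (hpq : q⁻¹ < p⁻¹) {u : ι → ℝ≥0∞} (hu : u ∈ weakUnitBall ι (p⁻¹ - q⁻¹)⁻¹) {f g : X → 𝕜}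
    (hf : Integrable f μ) (hg : MemLp g ∞ μ) {M : ℝ≥0∞}
    (hfg : ∀ i, ‖coeff e g i‖ₑ ≤ M * u i * ‖coeff e f i‖ₑ) :
    eLpNorm' g q μ ≤
      ENNReal.ofReal (2 * √((q - 1) / (p - 1))) * M * eLpNorm' f p μ := by
  set q' := q.conjExponent
  have hqq' : q.HolderConjugate q' := .conjExponent (by linarith)
  have hq'₁ : q' - 1 = (q - 1)⁻¹ :=
    eq_inv_of_mul_eq_one_left (by linear_combination hqq'.sub_one_mul_conj)
  have hq'₂ : q' ≤ 2 := by
    have := inv_le_one_of_one_le₀ (show 1 ≤ q - 1 by linarith)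
    linarith
  refine eLpNorm'_le_of_forall_enorm_integral_mul_conj_le hqq' hg fun h hh => ?_
  have hbilin := tsum_mul_enorm_coeff_mul_enorm_coeff_sq_le e.orthonormal hb hp₁ hp₂
    hqq'.symm.lt hq'₂ (inv_pos.2 (sub_pos.2 hpq))
    (by rw [inv_inv, ← hqq'.inv_add_inv_eq_one]; ring) hu hf (hh.integrable le_top)
  have hconst : ENNReal.ofReal (2 / (p - 1)) * ENNReal.ofReal (2 / (q' - 1)) =
      ENNReal.ofReal (2 * √((q - 1) / (p - 1))) ^ 2 := by
    rw [hq'₁, ← ENNReal.ofReal_mul (by bound), ← ENNReal.ofReal_pow (by positivity), mul_pow,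
      Real.sq_sqrt (by bound)]
    congr 1
    field_simp
  calc ‖∫ x, g x * starRingEnd 𝕜 (h x) ∂μ‖ₑ
      ≤ ∑' i, ‖coeff e g i‖ₑ * ‖coeff e h i‖ₑ :=
        enorm_integral_mul_conj_le_tsum e (hg.mono_exponent le_top) (hh.mono_exponent le_top)
    _ ≤ ∑' i, M * (u i * ‖coeff e f i‖ₑ * ‖coeff e h i‖ₑ) := by
        refine ENNReal.tsum_le_tsum fun i => ?_
        rw [← mul_assoc, ← mul_assoc]
        gcongr
        exact hfg i
    _ = M * ∑' i, u i * ‖coeff e f i‖ₑ * ‖coeff e h i‖ₑ := ENNReal.tsum_mul_left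
    _ ≤ M * (ENNReal.ofReal (2 * √((q - 1) / (p - 1))) * eLpNorm' f p μ * eLpNorm' h q' μ) := by
        gcongr
        rw [← ENNReal.pow_le_pow_left_iff two_ne_zero]
        refine hbilin.trans_eq ?_
        rw [mul_pow, mul_pow, ← hconst]
        ring
    _ = _ := by ring

end Multiplier

section FundDomain

variable {d : ℕ} {L : Submodule ℤ (EuclideanSpace ℝ (Fin d))} {Ω : Set (EuclideanSpace ℝ (Fin d))}

theorem IsFundDomain.isAddFundamentalDomain (hΩ : IsFundDomain L Ω) :
    IsAddFundamentalDomain L Ω volume := by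
  refine .mk' hΩ.nullMeasurableSet fun x => ?_
  obtain ⟨l, ⟨hl, hx⟩, huniq⟩ := hΩ.existsUnique x
  refine ⟨⟨l, hl⟩, ?_, fun g hg => Subtype.ext (huniq g ⟨g.2, ?_⟩)⟩
  · simpa [Submodule.vadd_def, add_comm] using hx
  · simpa [Submodule.vadd_def, add_comm] using hg

theorem IsFundDomain.eq_of_sub_mem (hΩ : IsFundDomain L Ω) {x y : EuclideanSpace ℝ (Fin d)}
    (hx : x ∈ Ω) (hy : y ∈ Ω) (h : x - y ∈ L) : x = y :=
  sub_eq_zero.1 <| (hΩ.existsUnique y).unique ⟨h, by simpa using hx⟩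
    ⟨L.zero_mem, by simpa using hy⟩

theorem IsFundDomain.preimage_add_right (hΩ : IsFundDomain L Ω) (y : EuclideanSpace ℝ (Fin d)) :
    IsFundDomain L ((fun x => x + y) ⁻¹' Ω) where
  nullMeasurableSet := hΩ.nullMeasurableSet.preimage
    (measurePreserving_add_right volume y).quasiMeasurePreserving
  existsUnique x := by
    simpa only [mem_preimage, add_right_comm] using hΩ.existsUnique (x + y)

instance : VAddInvariantMeasure L (EuclideanSpace ℝ (Fin d)) volume :=
  ⟨fun l _ _ => measure_preimage_add volume (l : EuclideanSpace ℝ (Fin d)) _⟩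

variable [DiscreteTopology L] [IsZLattice ℝ L]

theorem IsFundDomain.volume_ne_zero_and_ne_top (hΩ : IsFundDomain L Ω) :
    volume Ω ≠ 0 ∧ volume Ω ≠ ∞ := by
  rw [← ENNReal.toReal_ne_zero, ← measureReal_def,
    ← ZLattice.covolume_eq_measure_fundamentalDomain L volume hΩ.isAddFundamentalDomain]
  exact ZLattice.covolume_ne_zero L

theorem IsFundDomain.isProbabilityMeasure (hΩ : IsFundDomain L Ω) :
    IsProbabilityMeasure (normMeasure Ω) :=
  ⟨by
    obtain ⟨h0, htop⟩ := hΩ.volume_ne_zero_and_ne_top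
    simp [normMeasure, ENNReal.inv_mul_cancel h0 htop]⟩

theorem IsFundDomain.integral_add_right {E : Type*} [NormedAddCommGroup E] [NormedSpace ℝ E]
    (hΩ : IsFundDomain L Ω) {F : EuclideanSpace ℝ (Fin d) → E}
    (hF : ∀ x, ∀ l ∈ L, F (x + l) = F x) (y : EuclideanSpace ℝ (Fin d)) :
    ∫ x, F (x + y) ∂(normMeasure Ω) = ∫ x, F x ∂(normMeasure Ω) := by
  simp only [normMeasure, integral_smul_measure]
  congr 1
  rw [← (measurePreserving_add_right volume y).setIntegral_preimage_emb
    (measurableEmbedding_addRight y) F Ω]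
  refine hΩ.isAddFundamentalDomain.setIntegral_eq
    (hΩ.preimage_add_right y).isAddFundamentalDomain fun l x => ?_
  rw [Submodule.vadd_def, vadd_eq_add, add_comm (l : EuclideanSpace ℝ (Fin d)) x, add_right_comm,
    hF _ _ l.2]

theorem IsFundDomain.eq_of_ae_eq (hΩ : IsFundDomain L Ω) {f g : smoothPeriodic L}
    (h : f.1 =ᵐ[normMeasure Ω] g.1) : f = g := by
  refine Subtype.ext ((Continuous.ae_eq_iff_eq volume f.2.1.continuous g.2.1.continuous).1 ?_)
  refine hΩ.isAddFundamentalDomain.measure_zero_of_invariant {x | ¬f.1 x = g.1 x} (fun l => ?_) ?_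
  · ext x
    have hmem := neg_mem l.2
    simp [mem_vadd_set_iff_neg_vadd_mem, Submodule.vadd_def, add_comm, f.2.2 x _ hmem,
      g.2.2 x _ hmem]
  · obtain ⟨-, htop⟩ := hΩ.volume_ne_zero_and_ne_top
    rw [normMeasure, Filter.EventuallyEq,
      Measure.ae_ennreal_smul_measure_iff (ENNReal.inv_ne_zero.2 htop), ae_iff] at h
    rwa [← Measure.restrict_apply₀' hΩ.nullMeasurableSet]

theorem IsFundDomain.memLp (hΩ : IsFundDomain L Ω) (p : ℝ≥0∞) (f : smoothPeriodic L) :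
    MemLp f.1 p (normMeasure Ω) := by
  have := hΩ.isProbabilityMeasure
  obtain ⟨b, hb⟩ := (IsZLattice.isCompact_range_of_periodic L f.1 f.2.1.continuous
    f.2.2).isBounded.exists_norm_le
  exact .of_bound f.2.1.continuous.aestronglyMeasurable b (.of_forall fun x => hb _ ⟨x, rfl⟩)

/-- The inclusion `C^∞(Ω) → L^p(Ω)`. -/
def IsFundDomain.toLp (hΩ : IsFundDomain L Ω) (p : ℝ≥0∞) :
    smoothPeriodic L →ₗ[ℂ] Lp ℂ p (normMeasure Ω) where
  toFun f := (hΩ.memLp p f).toLp f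
  map_add' f g := (hΩ.memLp p f).toLp_add (hΩ.memLp p g)
  map_smul' c f := (hΩ.memLp p f).toLp_const_smul c

theorem IsFundDomain.toLp_injective (hΩ : IsFundDomain L Ω) (p : ℝ≥0∞) :
    Function.Injective (hΩ.toLp p) := fun _ _ h =>
  hΩ.eq_of_ae_eq ((MemLp.toLp_eq_toLp_iff (hΩ.memLp p _) (hΩ.memLp p _)).1 h)

end FundDomain

section Exponentials

variable {d : ℕ} {L : Submodule ℤ (EuclideanSpace ℝ (Fin d))} {Ω : Set (EuclideanSpace ℝ (Fin d))}

theorem fourierChar_inner_eq_one {κ l : EuclideanSpace ℝ (Fin d)} (hκ : κ ∈ dualLattice L)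
    (hl : l ∈ L) : 𝐞 (inner ℝ κ l) = 1 := by
  obtain ⟨n, hn⟩ := mem_dualLattice.1 hκ l hl
  ext
  rw [hn, Real.fourierChar_apply, Circle.coe_one, Complex.exp_eq_one_iff]
  exact ⟨n, by push_cast; ring⟩

theorem exists_fourierChar_inner_ne_one {V : Type*} [NormedAddCommGroup V]
    [InnerProductSpace ℝ V] {κ : V} (hκ : κ ≠ 0) : ∃ y, 𝐞 (inner ℝ κ y) ≠ 1 := by
  refine ⟨(2 * inner ℝ κ κ)⁻¹ • κ, fun h => ?_⟩
  have hhalf : inner ℝ κ ((2 * inner ℝ κ κ)⁻¹ • κ) = 2⁻¹ := by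
    rw [inner_smul_right]
    field_simp [inner_self_ne_zero.2 hκ]
  have hexp := congrArg (fun z : Circle => (z : ℂ)) h
  rw [hhalf, Real.fourierChar_apply, show 2 * Real.pi * 2⁻¹ = Real.pi by ring,
    Complex.exp_pi_mul_I, Circle.coe_one] at hexp
  norm_num at hexp

/-- The exponential `e^{2πi κ·x}`, `κ ∈ L^⊥`, as a smooth periodic function. -/
def expPeriodic (κ : dualLattice L) : smoothPeriodic L :=
  ⟨fun x => (𝐞 (inner ℝ κ.1 x) : Circle), by
    simp only [Real.fourierChar_apply]
    exact (Complex.ofRealCLM.contDiff.comp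
      (contDiff_const.mul (contDiff_const.inner ℝ contDiff_id))).mul contDiff_const |>.cexp,
  fun x l hl => by
    beta_reduce
    rw [inner_add_right, AddChar.map_add_eq_mul, fourierChar_inner_eq_one κ.2 hl, mul_one]⟩

theorem expPeriodic_mul_conj (κ κ' : dualLattice L) (x : EuclideanSpace ℝ (Fin d)) :
    (expPeriodic κ).1 x * starRingEnd ℂ ((expPeriodic κ').1 x) = (expPeriodic (κ - κ')).1 x := by
  simp only [expPeriodic, AddSubgroupClass.coe_sub, inner_sub_left, AddChar.map_sub_eq_div,
    div_eq_mul_inv, ← Circle.coe_inv_eq_conj, Circle.coe_mul]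

theorem fourierCoef_eq_integral_mul_conj (f : EuclideanSpace ℝ (Fin d) → ℂ) (κ : dualLattice L) :
    fourierCoef Ω f κ = ∫ x, f x * starRingEnd ℂ ((expPeriodic κ).1 x) ∂(normMeasure Ω) := by
  refine integral_congr_ae (.of_forall fun x => ?_)
  have hconj : starRingEnd ℂ ((expPeriodic κ).1 x) = (𝐞 (-inner ℝ κ.1 x) : Circle) := by
    rw [AddChar.map_neg_eq_inv, Circle.coe_inv_eq_conj]
    rfl
  beta_reduce
  rw [hconj, Real.fourierChar_apply]
  push_cast
  ring_nf

variable [DiscreteTopology L] [IsZLattice ℝ L]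

theorem IsFundDomain.integral_expPeriodic (hΩ : IsFundDomain L Ω) {κ : dualLattice L}
    (hκ : κ ≠ 0) : ∫ x, (expPeriodic κ).1 x ∂(normMeasure Ω) = 0 := by
  obtain ⟨y, hy⟩ := exists_fourierChar_inner_ne_one (fun h => hκ (Subtype.ext h))
  have hadd (x : EuclideanSpace ℝ (Fin d)) :
      (expPeriodic κ).1 (x + y) = (expPeriodic κ).1 x * 𝐞 (inner ℝ κ.1 y) := by
    simp only [expPeriodic, inner_add_right, AddChar.map_add_eq_mul, Circle.coe_mul]
  have hinv := hΩ.integral_add_right (expPeriodic κ).2.2 y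
  simp only [hadd, integral_mul_const] at hinv
  by_contra h0
  exact hy (Circle.ext (mul_left_cancel₀ h0 (hinv.trans (mul_one _).symm)))

theorem IsFundDomain.orthonormal_toLp_expPeriodic (hΩ : IsFundDomain L Ω) :
    Orthonormal ℂ fun κ : dualLattice L => hΩ.toLp 2 (expPeriodic κ) := by
  classical
  have := hΩ.isProbabilityMeasure
  rw [orthonormal_iff_ite]
  intro κ κ'
  have hinner : inner ℂ (hΩ.toLp 2 (expPeriodic κ)) (hΩ.toLp 2 (expPeriodic κ')) =
      ∫ x, (expPeriodic (κ' - κ)).1 x ∂(normMeasure Ω) := by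
    refine (coeff_eq_inner (e := fun κ => hΩ.toLp 2 (expPeriodic κ)) (hΩ.memLp 2 _) κ).symm.trans
      (integral_congr_ae ?_)
    filter_upwards [(hΩ.memLp 2 (expPeriodic κ)).coeFn_toLp] with x hx
    rw [← expPeriodic_mul_conj, ← hx]
    rfl
  rw [hinner]
  split_ifs with h
  · simp [h, expPeriodic]
  · exact hΩ.integral_expPeriodic (sub_ne_zero.2 (Ne.symm h))

end Exponentials

section Density

theorem compMeasurePreserving_surjective_of_injOn {X Y E : Type*} [MeasurableSpace X]
    [StandardBorelSpace X] [MeasurableSpace Y] [MeasurableSpace.CountablySeparated Y]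
    [NormedAddCommGroup E] {p : ℝ≥0∞} {μ : Measure X} {ν : Measure Y} {π : X → Y} {S : Set X}
    (hπ : MeasurePreserving π μ ν) (hS : MeasurableSet S) (hμS : ∀ᵐ x ∂μ, x ∈ S)
    (hinj : InjOn π S) :
    Function.Surjective (Lp.compMeasurePreserving (E := E) (p := p) π hπ) := by
  intro f
  have := hS.standardBorel
  have hemb : MeasurableEmbedding (S.domRestrict π) :=
    (hπ.measurable.comp measurable_subtype_coe).measurableEmbedding (injOn_iff_injective.1 hinj)
  obtain ⟨g, hg, hgf⟩ := hemb.exists_stronglyMeasurable_extend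
    ((Lp.stronglyMeasurable f).comp_measurable measurable_subtype_coe) fun _ => ⟨0⟩
  have hae : g ∘ π =ᵐ[μ] f := by
    filter_upwards [hμS] with x hx
    exact congrFun hgf ⟨x, hx⟩
  have hgLp : MemLp g p ν := by
    rw [← hπ.map_eq, memLp_map_measure_iff hg.aestronglyMeasurable hπ.measurable.aemeasurable,
      memLp_congr_ae hae]
    exact Lp.memLp f
  refine ⟨hgLp.toLp g, ?_⟩
  rw [Lp.toLp_compMeasurePreserving]
  exact Lp.ext ((MemLp.coeFn_toLp _).trans hae)

theorem topologicalClosure_span_toLp_mFourier {ι : Type*} [Fintype ι]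
    (ν : Measure (UnitAddTorus ι)) [IsFiniteMeasure ν] {p : ℝ≥0∞} [Fact (1 ≤ p)] (hp : p ≠ ∞) :
    (Submodule.span ℂ (range fun n : ι → ℤ =>
      ContinuousMap.toLp p ν ℂ (UnitAddTorus.mFourier n))).topologicalClosure = ⊤ := by
  have h := (ContinuousMap.toLp_denseRange ℂ ν ℂ hp).topologicalClosure_map_submodule
    UnitAddTorus.span_mFourier_closure_eq_top
  rwa [Submodule.map_span, ← range_comp] at h

variable {d : ℕ} {L : Submodule ℤ (EuclideanSpace ℝ (Fin d))} {Ω : Set (EuclideanSpace ℝ (Fin d))}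
  [DiscreteTopology L] [IsZLattice ℝ L] {ι : Type*}

/-- The coordinates of a point with respect to a basis of `L`, modulo integers. This is the
projection `ℝ^d → ℝ^d / L ≃ (ℝ / ℤ)^ι`. -/
def torusMap (b : Module.Basis ι ℤ L) (x : EuclideanSpace ℝ (Fin d)) : UnitAddTorus ι :=
  fun i => ((b.ofZLatticeBasis ℝ L).repr x i : UnitAddCircle)

theorem continuous_torusMap (b : Module.Basis ι ℤ L) : Continuous (torusMap b) :=
  continuous_pi fun i => (AddCircle.continuous_mk' (1 : ℝ)).comp
    ((b.ofZLatticeBasis ℝ L).coord i).continuous_of_finiteDimensional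

theorem sub_mem_of_torusMap_eq (b : Module.Basis ι ℤ L) {x y : EuclideanSpace ℝ (Fin d)}
    (h : torusMap b x = torusMap b y) : x - y ∈ L := by
  rw [← b.ofZLatticeBasis_span ℝ, Module.Basis.mem_span_iff_repr_mem]
  intro i
  have hi := congrFun h i
  rw [torusMap, torusMap, QuotientAddGroup.eq_iff_sub_mem, AddSubgroup.mem_zmultiples_iff] at hi
  obtain ⟨n, hn⟩ := hi
  exact ⟨n, by simpa using hn⟩

theorem exists_mem_dualLattice_inner_eq [Fintype ι] (b : Module.Basis ι ℤ L) (n : ι → ℤ) :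
    ∃ κ ∈ dualLattice L, ∀ x, inner ℝ κ x = ∑ i, n i * (b.ofZLatticeBasis ℝ L).repr x i := by
  let φ : EuclideanSpace ℝ (Fin d) →ₗ[ℝ] ℝ := ∑ i, (n i : ℝ) • (b.ofZLatticeBasis ℝ L).coord i
  let κ := (InnerProductSpace.toDual ℝ (EuclideanSpace ℝ (Fin d))).symm φ.toContinuousLinearMap
  have hκ (x) : inner ℝ κ x = ∑ i, n i * (b.ofZLatticeBasis ℝ L).repr x i :=
    InnerProductSpace.toDual_symm_apply.trans (by simp [φ])
  refine ⟨κ, mem_dualLattice.2 fun l hl => ⟨∑ i, n i * b.repr ⟨l, hl⟩ i, ?_⟩, hκ⟩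
  simp only [hκ, Int.cast_sum, Int.cast_mul, ← b.ofZLatticeBasis_repr_apply ℝ L ⟨l, hl⟩]

theorem exists_expPeriodic_eq_mFourier_torusMap [Fintype ι] (b : Module.Basis ι ℤ L)
    (n : ι → ℤ) :
    ∃ κ : dualLattice L, (expPeriodic κ).1 = UnitAddTorus.mFourier n ∘ torusMap b := by
  obtain ⟨κ, hκ, hinner⟩ := exists_mem_dualLattice_inner_eq b n
  refine ⟨⟨κ, hκ⟩, funext fun x => ?_⟩
  simp only [expPeriodic, Real.fourierChar_apply, hinner, UnitAddTorus.mFourier, Function.comp,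
    ContinuousMap.coe_mk, torusMap, fourier_coe_apply, ← Complex.exp_sum]
  push_cast
  simp only [Finset.mul_sum, Finset.sum_mul]
  exact congrArg _ (Finset.sum_congr rfl fun i _ => by ring)

theorem IsFundDomain.compMeasurePreserving_torusMap_surjective [Countable ι]
    (hΩ : IsFundDomain L Ω) (b : Module.Basis ι ℤ L) {ν : Measure (UnitAddTorus ι)}
    (hπ : MeasurePreserving (torusMap b) (normMeasure Ω) ν) (p : ℝ≥0∞) :
    Function.Surjective (Lp.compMeasurePreserving (E := ℂ) (p := p) (torusMap b) hπ) := by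
  obtain ⟨S, hSΩ, hSm, hSae⟩ := hΩ.nullMeasurableSet.exists_measurable_subset_ae_eq
  refine compMeasurePreserving_surjective_of_injOn hπ hSm (Measure.ae_smul_measure ?_ _)
    fun x hx y hy hxy => hΩ.eq_of_sub_mem (hSΩ hx) (hSΩ hy) (sub_mem_of_torusMap_eq b hxy)
  rw [← Measure.restrict_congr_set hSae]
  exact ae_restrict_mem hSm

theorem IsFundDomain.topologicalClosure_span_toLp_expPeriodic (hΩ : IsFundDomain L Ω) {p : ℝ≥0∞}
    [Fact (1 ≤ p)] (hp : p ≠ ∞) :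
    (Submodule.span ℂ (range fun κ : dualLattice L =>
      hΩ.toLp p (expPeriodic κ))).topologicalClosure = ⊤ := by
  have := ZLattice.module_free ℝ L
  have := ZLattice.module_finite ℝ L
  have := hΩ.isProbabilityMeasure
  let b := Module.Free.chooseBasis ℤ L
  let ν := (normMeasure Ω).map (torusMap b)
  have hπ : MeasurePreserving (torusMap b) (normMeasure Ω) ν :=
    (continuous_torusMap b).measurable.measurePreserving _
  let Φ : Lp ℂ p ν →L[ℂ] Lp ℂ p (normMeasure Ω) :=
    (Lp.compMeasurePreservingₗᵢ ℂ (torusMap b) hπ).toContinuousLinearMap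
  have hΦ : Function.Surjective Φ := hΩ.compMeasurePreserving_torusMap_surjective b hπ p
  rw [eq_top_iff, ← hΦ.denseRange.topologicalClosure_map_submodule
    (topologicalClosure_span_toLp_mFourier ν hp), Submodule.map_span, ← range_comp]
  refine Submodule.topologicalClosure_mono (Submodule.span_mono ?_)
  rintro _ ⟨n, rfl⟩
  obtain ⟨κ, hκ⟩ := exists_expPeriodic_eq_mFourier_torusMap b n
  have hpull : Φ (ContinuousMap.toLp p ν ℂ (UnitAddTorus.mFourier n)) =ᵐ[normMeasure Ω]
      UnitAddTorus.mFourier n ∘ torusMap b :=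
    (Lp.coeFn_compMeasurePreserving _ hπ).trans
      (hπ.quasiMeasurePreserving.ae_eq_comp (ContinuousMap.coeFn_toLp ν _))
  exact ⟨κ, Lp.ext ((hΩ.memLp p (expPeriodic κ)).coeFn_toLp.trans (hκ ▸ hpull.symm))⟩

theorem IsFundDomain.denseRange_toLp (hΩ : IsFundDomain L Ω) {p : ℝ≥0∞} [Fact (1 ≤ p)]
    (hp : p ≠ ∞) : DenseRange (hΩ.toLp p) := by
  rw [DenseRange, ← LinearMap.coe_range, Submodule.dense_iff_topologicalClosure_eq_top, eq_top_iff,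
    ← hΩ.topologicalClosure_span_toLp_expPeriodic hp]
  refine Submodule.topologicalClosure_mono (Submodule.span_le.2 ?_)
  rintro _ ⟨κ, rfl⟩
  exact LinearMap.mem_range_self _ _

end Density

section FourierMultiplier

variable {d : ℕ} {L : Submodule ℤ (EuclideanSpace ℝ (Fin d))} {Ω : Set (EuclideanSpace ℝ (Fin d))}
  {σ : dualLattice L → ℂ} {p q : ℝ≥0∞}

theorem mul_encard_rpow_le_symbolSup (σ : dualLattice L → ℂ) (hpq : q.toReal⁻¹ < p.toReal⁻¹)
    (s : ℝ≥0∞) :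
    s * ({κ | s ≤ ‖σ κ‖ₑ}.encard : ℝ≥0∞) ^ (p.toReal⁻¹ - q.toReal⁻¹) ≤ symbolSup σ p q := by
  rcases eq_or_ne s 0 with rfl | h0
  · simp
  induction s with
  | top => simp [ENNReal.zero_rpow_of_pos (sub_pos.2 hpq)]
  | coe s =>
    have hlevel : {κ | (s : ℝ≥0∞) ≤ ‖σ κ‖ₑ} = {κ | (s : ℝ) ≤ ‖σ κ‖} := by
      simp only [enorm_eq_nnnorm, ENNReal.coe_le_coe, ← coe_nnnorm, NNReal.coe_le_coe]
    rw [hlevel, ← ENNReal.ofReal_coe_nnreal, ← one_div, ← one_div]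
    exact le_iSup₂_of_le (s : ℝ) (NNReal.coe_pos.2 (pos_of_ne_zero (mod_cast h0))) le_rfl

theorem enorm_le_symbolSup (σ : dualLattice L → ℂ) (hpq : q.toReal⁻¹ < p.toReal⁻¹)
    (κ : dualLattice L) : ‖σ κ‖ₑ ≤ symbolSup σ p q := by
  refine le_trans (le_mul_of_one_le_right' (ENNReal.one_le_rpow ?_ (sub_pos.2 hpq)))
    (mul_encard_rpow_le_symbolSup σ hpq ‖σ κ‖ₑ)
  exact_mod_cast one_le_encard_iff_nonempty.2 ⟨κ, le_refl ‖σ κ‖ₑ⟩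

theorem enorm_div_symbolSup_mem_weakUnitBall (hpq : q.toReal⁻¹ < p.toReal⁻¹)
    (hfin : symbolSup σ p q ≠ ∞) :
    (fun κ => ‖σ κ‖ₑ / symbolSup σ p q) ∈
      weakUnitBall (dualLattice L) (p.toReal⁻¹ - q.toReal⁻¹)⁻¹ := by
  intro s
  have hδ : 0 < p.toReal⁻¹ - q.toReal⁻¹ := sub_pos.2 hpq
  rcases eq_or_ne s 0 with rfl | hs
  · simp [ENNReal.zero_rpow_of_neg (neg_neg_of_pos (inv_pos.2 hδ))]
  rcases eq_or_ne (symbolSup σ p q) 0 with h0 | h0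
  · have hσ (κ : dualLattice L) : σ κ = 0 :=
      enorm_eq_zero.1 (nonpos_iff_eq_zero.1 (h0 ▸ enorm_le_symbolSup σ hpq κ))
    simp [hσ, hs]
  simp only [ENNReal.le_div_iff_mul_le (.inl h0) (.inl hfin)]
  have hlevel := mul_encard_rpow_le_symbolSup σ hpq (s * symbolSup σ p q)
  rw [mul_right_comm, ← ENNReal.le_div_iff_mul_le (.inl h0) (.inl hfin),
    ENNReal.div_self h0 hfin, mul_comm, ← ENNReal.le_inv_iff_mul_le] at hlevel
  rw [ENNReal.rpow_neg, ← ENNReal.inv_rpow]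
  exact (ENNReal.le_rpow_inv_iff hδ).2 hlevel

variable [DiscreteTopology L] [IsZLattice ℝ L]

/-- The exponentials `e^{2πi κ·x}`, `κ ∈ L^⊥`, as an orthonormal basis of `L²(Ω)`. -/
def IsFundDomain.hilbertBasis (hΩ : IsFundDomain L Ω) :
    HilbertBasis (dualLattice L) ℂ (Lp ℂ 2 (normMeasure Ω)) :=
  .mk hΩ.orthonormal_toLp_expPeriodic
    (hΩ.topologicalClosure_span_toLp_expPeriodic (p := 2) ENNReal.ofNat_ne_top).ge

theorem IsFundDomain.hilbertBasis_ae_eq (hΩ : IsFundDomain L Ω) (κ : dualLattice L) :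
    hΩ.hilbertBasis κ =ᵐ[normMeasure Ω] (expPeriodic κ).1 := by
  rw [hilbertBasis, HilbertBasis.coe_mk]
  exact (hΩ.memLp 2 (expPeriodic κ)).coeFn_toLp

theorem IsFundDomain.norm_hilbertBasis_le (hΩ : IsFundDomain L Ω) (κ : dualLattice L) :
    ∀ᵐ x ∂(normMeasure Ω), ‖hΩ.hilbertBasis κ x‖ ≤ 1 := by
  filter_upwards [hΩ.hilbertBasis_ae_eq κ] with x hx
  rw [hx]
  exact (Circle.norm_coe _).le

theorem IsFundDomain.coeff_hilbertBasis (hΩ : IsFundDomain L Ω)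
    (f : EuclideanSpace ℝ (Fin d) → ℂ) (κ : dualLattice L) :
    coeff hΩ.hilbertBasis f κ = fourierCoef Ω f κ := by
  rw [coeff, fourierCoef_eq_integral_mul_conj]
  refine integral_congr_ae ?_
  filter_upwards [hΩ.hilbertBasis_ae_eq κ] with x hx
  rw [hx]

theorem IsFundDomain.repr_hilbertBasis_toLp (hΩ : IsFundDomain L Ω) (f : smoothPeriodic L)
    (κ : dualLattice L) : hΩ.hilbertBasis.repr (hΩ.toLp 2 f) κ = fourierCoef Ω f.1 κ := by
  rw [HilbertBasis.repr_apply_apply, ← hΩ.coeff_hilbertBasis, coeff_eq_inner (hΩ.memLp 2 f)]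
  rfl

theorem IsFundDomain.eq_of_fourierCoef_eq (hΩ : IsFundDomain L Ω) {f g : smoothPeriodic L}
    (h : ∀ κ : dualLattice L, fourierCoef Ω f.1 κ = fourierCoef Ω g.1 κ) : f = g := by
  refine hΩ.toLp_injective 2 (hΩ.hilbertBasis.repr.injective (lp.ext (funext fun κ => ?_)))
  rw [hΩ.repr_hilbertBasis_toLp, hΩ.repr_hilbertBasis_toLp, h κ]

theorem IsFourierMultiplier.isLinearMap {A : smoothPeriodic L → smoothPeriodic L}
    (hA : IsFourierMultiplier L Ω A σ) (hΩ : IsFundDomain L Ω) : IsLinearMap ℂ A where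
  map_add f g := hΩ.eq_of_fourierCoef_eq fun κ => by
    rw [hA]
    simp only [← hΩ.repr_hilbertBasis_toLp, map_add, lp.coeFn_add, Pi.add_apply]
    simp only [hΩ.repr_hilbertBasis_toLp, hA _ κ, mul_add]
  map_smul c f := hΩ.eq_of_fourierCoef_eq fun κ => by
    rw [hA]
    simp only [← hΩ.repr_hilbertBasis_toLp, map_smul, lp.coeFn_smul, Pi.smul_apply, smul_eq_mul]
    simp only [hΩ.repr_hilbertBasis_toLp, hA _ κ, mul_left_comm]

theorem IsFourierMultiplier.eLpNorm_le {A : smoothPeriodic L → smoothPeriodic L}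
    (hA : IsFourierMultiplier L Ω A σ) (hΩ : IsFundDomain L Ω) (hp1 : 1 < p) (hp2 : p ≤ 2)
    (hq2 : 2 ≤ q) (hq : q ≠ ∞) (hpq : p < q) (hfin : symbolSup σ p q ≠ ∞)
    (f : smoothPeriodic L) :
    eLpNorm (A f).1 q (normMeasure Ω) ≤
      ENNReal.ofReal (2 * √((q.toReal - 1) / (p.toReal - 1))) * symbolSup σ p q *
        eLpNorm f.1 p (normMeasure Ω) := by
  have := hΩ.isProbabilityMeasure
  have hp : p ≠ ∞ := hpq.ne_top
  have hp0 : p ≠ 0 := (zero_lt_one.trans hp1).ne'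
  have hpr : 1 < p.toReal := (ENNReal.toReal_lt_toReal ENNReal.one_ne_top hp).2 hp1
  have hpr2 : p.toReal ≤ 2 := (ENNReal.toReal_le_toReal hp ENNReal.ofNat_ne_top).2 hp2
  have hqr : 2 ≤ q.toReal := (ENNReal.toReal_le_toReal ENNReal.ofNat_ne_top hq).2 hq2
  have hinv : q.toReal⁻¹ < p.toReal⁻¹ :=
    inv_strictAnti₀ (by linarith) ((ENNReal.toReal_lt_toReal hp hq).2 hpq)
  rw [eLpNorm_eq_eLpNorm' hp0 hp, eLpNorm_eq_eLpNorm' (two_pos.trans_le hq2).ne' hq]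
  refine eLpNorm'_le_of_enorm_coeff_le hΩ.hilbertBasis hΩ.norm_hilbertBasis_le hpr hpr2 hqr hinv
    (enorm_div_symbolSup_mem_weakUnitBall hinv hfin) ((hΩ.memLp 1 f).integrable le_rfl)
    (hΩ.memLp ∞ (A f)) fun κ => ?_
  have hσ := enorm_le_symbolSup σ hinv κ
  rw [hΩ.coeff_hilbertBasis, hΩ.coeff_hilbertBasis, hA, enorm_mul,
    ENNReal.mul_div_cancel' (fun h => nonpos_iff_eq_zero.1 (h ▸ hσ)) (fun h => (hfin h).elim)]

theorem IsFundDomain.exists_continuousLinearMap_extension [Fact (1 ≤ p)] [Fact (1 ≤ q)]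
    (hΩ : IsFundDomain L Ω) (hp : p ≠ ∞) (A : smoothPeriodic L →ₗ[ℂ] smoothPeriodic L) {C : ℝ≥0}
    (hA : ∀ f, eLpNorm (A f).1 q (normMeasure Ω) ≤ C * eLpNorm f.1 p (normMeasure Ω)) :
    ∃ T : Lp ℂ p (normMeasure Ω) →L[ℂ] Lp ℂ q (normMeasure Ω),
      (∀ f, T (hΩ.toLp p f) = hΩ.toLp q (A f)) ∧ ‖T‖ ≤ C := by
  have hdense := hΩ.denseRange_toLp hp
  have hnorm (f) : ‖(hΩ.toLp q ∘ₗ A) f‖ ≤ C * ‖hΩ.toLp p f‖ := by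
    have h : ‖hΩ.toLp q (A f)‖ₑ ≤ C * ‖hΩ.toLp p f‖ₑ := by
      simpa only [toLp, LinearMap.coe_mk, AddHom.coe_mk, Lp.enorm_toLp] using hA f
    simp only [enorm_eq_nnnorm, ← ENNReal.coe_mul, ENNReal.coe_le_coe] at h
    exact NNReal.coe_le_coe.2 h
  exact ⟨(hΩ.toLp q ∘ₗ A).extendOfNorm (hΩ.toLp p),
    LinearMap.extendOfNorm_eq hdense ⟨C, hnorm⟩,
    LinearMap.opNorm_extendOfNorm_le hdense C.coe_nonneg hnorm⟩

end FourierMultiplier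

end LatticeFourier

end

theorem mainTheorem1 (p q : ℝ≥0∞) [Fact (1 ≤ p)] [Fact (1 ≤ q)]
    (hp1 : 1 < p) (hp2 : p ≤ 2) (hq2 : 2 ≤ q) (hq : q < ∞) (hpq : ¬(p = 2 ∧ q = 2)) :
    ∃ C : ℝ≥0, 0 < C ∧
      ∀ (d : ℕ) (L : Submodule ℤ (EuclideanSpace ℝ (Fin d)))
        [DiscreteTopology L] [IsZLattice ℝ L]
        (Ω : Set (EuclideanSpace ℝ (Fin d))) (_ : IsFundDomain L Ω)
        (A : smoothPeriodic L → smoothPeriodic L) (σ : dualLattice L → ℂ)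
        (_ : IsFourierMultiplier L Ω A σ) (_ : symbolSup σ p q < ∞),
        smoothOpNorm Ω A p q ≤ C * symbolSup σ p q ∧
        ∃ T : Lp ℂ p (normMeasure Ω) →L[ℂ] Lp ℂ q (normMeasure Ω),
          (∀ f : smoothPeriodic L,
            ∃ (hf : MemLp (f : EuclideanSpace ℝ (Fin d) → ℂ) p (normMeasure Ω))
              (hAf : MemLp (A f : EuclideanSpace ℝ (Fin d) → ℂ) q (normMeasure Ω)),
              T (hf.toLp f) = hAf.toLp (A f)) ∧
          ‖T‖ ≤ C * (symbolSup σ p q).toReal := by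
  have hlt : p < q := (hp2.trans hq2).lt_of_ne fun h =>
    hpq ⟨hp2.antisymm (h ▸ hq2), (h ▸ hp2).antisymm hq2⟩
  have hpr : 1 < p.toReal := (ENNReal.toReal_lt_toReal ENNReal.one_ne_top hlt.ne_top).2 hp1
  have hqr : 1 < q.toReal := hpr.trans ((ENNReal.toReal_lt_toReal hlt.ne_top hq.ne).2 hlt)
  refine ⟨(2 * √((q.toReal - 1) / (p.toReal - 1))).toNNReal, ?_,
    fun d L _ _ Ω hΩ A σ hA hfin => ?_⟩
  · have := div_pos (sub_pos.2 hqr) (sub_pos.2 hpr)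
    positivity
  have hbound := hA.eLpNorm_le hΩ hp1 hp2 hq2 hq.ne hlt hfin.ne
  refine ⟨iSup₂_le fun f _ => ENNReal.div_le_of_le_mul (hbound f), ?_⟩
  lift symbolSup σ p q to ℝ≥0 using hfin.ne with M
  obtain ⟨T, hT, hTnorm⟩ := hΩ.exists_continuousLinearMap_extension hlt.ne_top
    (IsLinearMap.mk' A (hA.isLinearMap hΩ)) (by exact_mod_cast hbound)
  exact ⟨T, fun f => ⟨hΩ.memLp p f, hΩ.memLp q (A f), hT f⟩, hTnorm⟩
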